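/- Let $p$ be a prime, and let $\delta=1$ if $p>2$ and $\delta=2$ if $p=2$. Let $f,u\in\mathbb{Z}_p[[x]]$ be power series with $f(0)=u(0)=0$ and $f'(0),u'(0)\neq 0$, where $f$ is not invertible under composition, $u$ is invertible and of infinite order under composition, and $f\circ u=u\circ f$. Suppose that the pair is minimal, that is, the first coefficient of $f$ not divisible by $p$ is that of $x^p$, $v_p(f'(0))=1$, and $v_p(u'(0)-1)=\delta$. Let $\mathfrak{m}^{\mathrm{alg}}$ be the maximal ideal of the integral closure of $\mathbb{Z}_p$ in an algebraic closure of $\mathbb{Q}_p$, let $g^{\circ n}$ denote the $n$-fold iterate of $g$ under composition, and for $n\geq 0$ put $$\Lambda_f(n)=\{\pi\in\mathfrak{m}^{\mathrm{alg}} : f^{\circ n}(\pi)=0\},\qquad \Lambda_u(n)=\{\pi\in\mathfrak{m}^{\mathrm{alg}} : u^{\circ p^n}(\pi)=\pi\},\qquad \Omega_f(n+1)=\Lambda_f(n+1)\setminus\Lambda_f(n).$$ Then for every integer $n\geq\delta$ the following hold. 1. If $\pi\in\Omega_f(n+1)$ and $i,j\geq 0$ are integers, then $u^{\circ i}(\pi)=u^{\circ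 j}(\pi)$ if and only if $p^{\,n-\delta+1}$ divides $j-i$. 2. $\Lambda_f(n)=\Lambda_u(n-\delta)$. -/

import Mathlib

namespace PadicDyn

noncomputable section

section Series

variable {R : Type*} [CommRing R]

/-- The composite `g ∘ h`, that is `g(h(x))`, of two power series (used only for `h(0) = 0`). -/
def comp (g h : PowerSeries R) : PowerSeries R := PowerSeries.subst h g

/-- The `n`-fold iterate of `g` under composition, starting from the series `x` for `n = 0`. -/
def iter (g : PowerSeries R) : ℕ → PowerSeries R
  | 0 => PowerSeries.X
  | n + 1 => comp g (iter g n)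

/-- Series with `g(0) = 0` and `g'(0) ≠ 0`. -/
def S₀ (R : Type*) [CommRing R] : Set (PowerSeries R) :=
  {g | PowerSeries.constantCoeff g = 0 ∧ PowerSeries.coeff 1 g ≠ 0}

/-- Series in `S₀ R` that are invertible under composition. -/
def G₀ (R : Type*) [CommRing R] : Set (PowerSeries R) :=
  {g | g ∈ S₀ R ∧ IsUnit (PowerSeries.coeff 1 g)}

/-- Torsion under composition. -/
def IsTorsion (g : PowerSeries R) : Prop := ∃ n : ℕ, 0 < n ∧ iter g n = PowerSeries.X

/-- A commuting pair: `f` is noninvertible, `u` is invertible and nontorsion, `f ∘ u = u ∘ f`. -/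
structure IsCommutingPair (f u : PowerSeries R) : Prop where
  f_mem : f ∈ S₀ R
  f_noninvertible : f ∉ G₀ R
  u_invertible : u ∈ G₀ R
  u_nontorsion : ¬ IsTorsion u
  commute : comp f u = comp u f

/-- The Weierstrass degree: the order of vanishing of the reduction modulo the maximal ideal. -/
def wideg [IsLocalRing R] (g : PowerSeries R) : ℕ∞ :=
  (PowerSeries.map (IsLocalRing.residue R) g).order

end Series

/-- `δ = 1` if `p > 2` and `δ = 2` if `p = 2`. -/
def delta (p : ℕ) : ℕ := if p = 2 then 2 else 1

variable {p : ℕ} [Fact p.Prime]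

/-- Minimal commuting pairs over `ℤ_p`. As the prescribed valuations are positive, the convention
`PadicInt.valuation 0 = 0` plays no role. -/
structure IsMinimalCommutingPair (f u : PowerSeries ℤ_[p]) : Prop
    extends IsCommutingPair f u where
  wideg_eq : wideg f = (p : ℕ∞)
  valuation_f : (PowerSeries.coeff 1 f).valuation = 1
  valuation_u : (PowerSeries.coeff 1 u - 1).valuation = delta p

/-- The maximal ideal of the integral closure of `ℤ_p` in the algebraic closure of `ℚ_p`, as a set:
the open unit disc for the unique extension of the `p`-adic absolute value. -/
def mAlg (p : ℕ) [Fact p.Prime] : Set (PadicAlgCl p) := {x | ‖x‖ < 1}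

/-- The value `g(x)` of a series over `ℤ_p`. For `x` in `mAlg p` the sum converges, because the
finite extension `ℚ_p(x)` is complete. -/
def eval (g : PowerSeries ℤ_[p]) (x : PadicAlgCl p) : PadicAlgCl p :=
  ∑' k : ℕ, algebraMap ℚ_[p] (PadicAlgCl p) ((PowerSeries.coeff k g : ℤ_[p]) : ℚ_[p]) * x ^ k

/-- `Λ_f(n)` for noninvertible `f`: the roots of the `n`-fold iterate of `f`. -/
def rootSet (f : PowerSeries ℤ_[p]) (n : ℕ) : Set (PadicAlgCl p) :=
  {x | x ∈ mAlg p ∧ eval (iter f n) x = 0}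

/-- `Λ_u(n)` for invertible `u`: the fixed points of the `p ^ n`-fold iterate of `u`. -/
def fixedSet (u : PowerSeries ℤ_[p]) (n : ℕ) : Set (PadicAlgCl p) :=
  {x | x ∈ mAlg p ∧ eval (iter u (p ^ n)) x = x}

/-- `Ω_f(n) = Λ_f(n) \ Λ_f(n - 1)`, with `Λ_f(-1)` empty. -/
def newRootSet (f : PowerSeries ℤ_[p]) : ℕ → Set (PadicAlgCl p)
  | 0 => rootSet f 0
  | n + 1 => rootSet f (n + 1) \ rootSet f n

end

end PadicDyn

/-!
Since `f'(0)` is a uniformizer, each quotient `f^{∘(m+1)} / f^{∘m}` is, up to a unit, an Eisenstein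
polynomial, so the iterates of `f` have simple zeros and each quotient divides every series sharing
a zero with it. It follows that `f' ≡ 0` modulo `p`, and hence that a series commuting with `f` and
congruent to `x` modulo `p` equals `x`.

Let `v` commute with `f`, with `v'(0) ≠ 1`. The fixed points of `v` are zeros of iterates of `f`,
and at each of them `v'` takes the value `v'(0) ≠ 1`, so they are simple zeros of `v(x) - x`.
Dividing by one quotient after another, `v(x) - x` is a unit times `f^{∘M}`, where comparing linear
coefficients gives `M = v_p(v'(0) - 1)`. For `v = u^{∘d}` lifting the exponent computes this `M`.
-/

namespace PadicDyn

open PowerSeries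

section Formal

variable {R S : Type*} [CommRing R] [CommRing S]

theorem comp_X (g : PowerSeries R) : comp g X = g := X_subst g

theorem X_comp {h : PowerSeries R} (hh : constantCoeff h = 0) : comp X h = h :=
  subst_X (HasSubst.of_constantCoeff_zero' hh)

theorem comp_C (a : R) (h : PowerSeries R) : comp (C a) h = C a := subst_C a

theorem comp_add (a b : PowerSeries R) {h : PowerSeries R} (hh : constantCoeff h = 0) :
    comp (a + b) h = comp a h + comp b h :=
  subst_add (HasSubst.of_constantCoeff_zero' hh) a b

theorem comp_mul (a b : PowerSeries R) {h : PowerSeries R} (hh : constantCoeff h = 0) :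
    comp (a * b) h = comp a h * comp b h :=
  subst_mul (HasSubst.of_constantCoeff_zero' hh) a b

theorem comp_pow (a : PowerSeries R) (n : ℕ) {h : PowerSeries R} (hh : constantCoeff h = 0) :
    comp (a ^ n) h = comp a h ^ n :=
  subst_pow (HasSubst.of_constantCoeff_zero' hh) a n

theorem comp_coe (P : Polynomial R) {h : PowerSeries R} (hh : constantCoeff h = 0) :
    comp (P : PowerSeries R) h = Polynomial.aeval h P :=
  subst_coe (HasSubst.of_constantCoeff_zero' hh) P

theorem comp_assoc (a : PowerSeries R) {b c : PowerSeries R} (hb : constantCoeff b = 0)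
    (hc : constantCoeff c = 0) : comp (comp a b) c = comp a (comp b c) :=
  subst_comp_subst_apply (HasSubst.of_constantCoeff_zero' hb)
    (HasSubst.of_constantCoeff_zero' hc) a

theorem map_comp (φ : R →+* S) (g : PowerSeries R) {h : PowerSeries R}
    (hh : constantCoeff h = 0) : map φ (comp g h) = comp (map φ g) (map φ h) :=
  map_subst (HasSubst.of_constantCoeff_zero' hh) g

theorem constantCoeff_map (φ : R →+* S) (g : PowerSeries R) :
    constantCoeff (map φ g) = φ (constantCoeff g) :=
  MvPowerSeries.constantCoeff_map φ g

theorem constantCoeff_comp (g : PowerSeries R) {h : PowerSeries R} (hh : constantCoeff h = 0) :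
    constantCoeff (comp g h) = constantCoeff g := by
  conv_lhs => rw [eq_X_mul_shift_add_const g]
  rw [comp_add _ _ hh, comp_mul _ _ hh, X_comp hh, comp_C]
  simp [hh]

theorem derivative_comp (g : PowerSeries R) {h : PowerSeries R} (hh : constantCoeff h = 0) :
    d⁄dX R (comp g h) = comp (d⁄dX R g) h * d⁄dX R h :=
  derivative_subst (HasSubst.of_constantCoeff_zero' hh)

theorem constantCoeff_derivative (g : PowerSeries R) :
    constantCoeff (d⁄dX R g) = coeff 1 g := by
  rw [← coeff_zero_eq_constantCoeff_apply, coeff_derivative]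
  simp

theorem map_derivative (φ : R →+* S) (g : PowerSeries R) :
    map φ (d⁄dX R g) = d⁄dX S (map φ g) := by
  ext n
  simp only [coeff_map, coeff_derivative, map_mul, map_add, map_natCast, map_one]

theorem coeff_one_comp (g : PowerSeries R) {h : PowerSeries R} (hh : constantCoeff h = 0) :
    coeff 1 (comp g h) = coeff 1 g * coeff 1 h := by
  rw [← constantCoeff_derivative, derivative_comp g hh, map_mul, constantCoeff_comp _ hh,
    constantCoeff_derivative, constantCoeff_derivative]

theorem comp_X_add_of_sq_eq_zero (f : PowerSeries R) {e : PowerSeries R}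
    (he : constantCoeff e = 0) (he2 : e ^ 2 = 0) : comp f (X + e) = f + d⁄dX R f * e := by
  have hXe : constantCoeff (X + e) = 0 := by rw [map_add, constantCoeff_X, he, add_zero]
  have hX_dvd : X ∣ X + e := X_dvd_iff.mpr hXe
  suffices h : ∀ N, X ^ N ∣ comp f (X + e) - (f + d⁄dX R f * e) by
    refine sub_eq_zero.mp (PowerSeries.ext fun n => ?_)
    exact X_pow_dvd_iff.mp (h (n + 1)) n n.lt_succ_self
  intro N
  set r : PowerSeries R := mk fun i => coeff (i + (N + 1)) f
  have hf : f = X ^ (N + 1) * r + (trunc (N + 1) f : PowerSeries R) :=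
    eq_X_pow_mul_shift_add_trunc (N + 1) f
  have htrunc : comp (trunc (N + 1) f : PowerSeries R) (X + e) =
      trunc (N + 1) f + d⁄dX R (trunc (N + 1) f : PowerSeries R) * e := by
    rw [comp_coe _ hXe, Polynomial.aeval_add_of_sq_eq_zero _ _ _ he2, derivative_coe,
      ← comp_coe _ constantCoeff_X, ← comp_coe _ constantCoeff_X, comp_X, comp_X]
  have hdiff : comp f (X + e) - (f + d⁄dX R f * e) =
      (X + e) ^ (N + 1) * comp r (X + e) - X ^ (N + 1) * r
        - d⁄dX R (X ^ (N + 1) * r) * e := by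
    conv_lhs => rw [hf]
    rw [comp_add _ _ hXe, htrunc, comp_mul _ _ hXe, comp_pow _ _ hXe, X_comp hXe, map_add]
    ring
  have hpow : X ^ N ∣ (X : PowerSeries R) ^ (N + 1) := pow_dvd_pow _ N.le_succ
  have hderiv : X ^ N ∣ d⁄dX R (X ^ (N + 1) * r) := by
    rw [Derivation.leibniz, Derivation.leibniz_pow, smul_eq_mul, smul_eq_mul, smul_eq_mul,
      nsmul_eq_mul, Nat.add_sub_cancel]
    exact dvd_add (hpow.mul_right _) (((dvd_mul_right _ _).mul_left _).mul_left _)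
  rw [hdiff]
  exact dvd_sub (dvd_sub ((hpow.trans (pow_dvd_pow_of_dvd hX_dvd _)).mul_right _)
    (hpow.mul_right _)) (hderiv.mul_right _)

theorem eq_zero_of_comp_eq_zero [IsDomain R] {g h : PowerSeries R} (hh : constantCoeff h = 0)
    (h0 : h ≠ 0) (hgh : comp g h = 0) : g = 0 := by
  by_contra hg
  have hcomp : comp g h = h ^ g.order.toNat * comp (divXPowOrder g) h := by
    conv_lhs => rw [← X_pow_order_mul_divXPowOrder (f := g)]
    rw [comp_mul _ _ hh, comp_pow _ _ hh, X_comp hh]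
  rw [hcomp, mul_eq_zero, or_iff_right (pow_ne_zero _ h0)] at hgh
  refine hg (constantCoeff_divXPowOrder_eq_zero_iff.mp ?_)
  rw [← constantCoeff_comp _ hh, hgh, map_zero]

theorem constantCoeff_iter {g : PowerSeries R} (hg : constantCoeff g = 0) (n : ℕ) :
    constantCoeff (iter g n) = 0 := by
  induction n with
  | zero => exact constantCoeff_X
  | succ n ih => rw [iter, constantCoeff_comp _ ih, hg]

theorem coeff_one_iter {g : PowerSeries R} (hg : constantCoeff g = 0) (n : ℕ) :
    coeff 1 (iter g n) = coeff 1 g ^ n := by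
  induction n with
  | zero => simp [iter]
  | succ n ih => rw [iter, coeff_one_comp _ (constantCoeff_iter hg n), ih, pow_succ']

theorem iter_one (g : PowerSeries R) : iter g 1 = g := comp_X g

theorem iter_add {g : PowerSeries R} (hg : constantCoeff g = 0) (m n : ℕ) :
    iter g (m + n) = comp (iter g m) (iter g n) := by
  induction m with
  | zero => rw [zero_add, iter, X_comp (constantCoeff_iter hg n)]
  | succ m ih =>
    rw [Nat.succ_add, iter, ih, iter,
      comp_assoc _ (constantCoeff_iter hg m) (constantCoeff_iter hg n)]

theorem comp_iter_comm {a b : PowerSeries R} (ha : constantCoeff a = 0)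
    (hb : constantCoeff b = 0) (hab : comp a b = comp b a) (n : ℕ) :
    comp a (iter b n) = comp (iter b n) a := by
  induction n with
  | zero => rw [iter, comp_X, X_comp ha]
  | succ n ih =>
    have hn := constantCoeff_iter hb n
    rw [iter, ← comp_assoc _ hb hn, hab, comp_assoc _ ha hn, ih, comp_assoc _ hn ha]

/-- The series `f(x) / x`, for `f(0) = 0`; in general, `(f(x) - f(0)) / x`. -/
noncomputable def shift (f : PowerSeries R) : PowerSeries R := mk fun i => coeff (i + 1) f

theorem X_mul_shift {f : PowerSeries R} (hf : constantCoeff f = 0) : X * shift f = f := by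
  conv_rhs => rw [eq_X_mul_shift_add_const f]
  simp [hf, shift]

theorem constantCoeff_shift (f : PowerSeries R) : constantCoeff (shift f) = coeff 1 f := by
  rw [← coeff_zero_eq_constantCoeff_apply, shift, coeff_mk]

/-- The quotient `f^{∘(m+1)} / f^{∘m}` of consecutive iterates of a series with `f(0) = 0`. -/
noncomputable def iterQuot (f : PowerSeries R) (m : ℕ) : PowerSeries R := comp (shift f) (iter f m)

theorem iter_succ_eq_mul {f : PowerSeries R} (hf : constantCoeff f = 0) (m : ℕ) :
    iter f (m + 1) = iter f m * iterQuot f m := by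
  have hm := constantCoeff_iter hf m
  calc comp f (iter f m) = comp (X * shift f) (iter f m) := by rw [X_mul_shift hf]
    _ = iter f m * iterQuot f m := by rw [comp_mul _ _ hm, X_comp hm, iterQuot]

theorem constantCoeff_iterQuot {f : PowerSeries R} (hf : constantCoeff f = 0) (m : ℕ) :
    constantCoeff (iterQuot f m) = coeff 1 f := by
  rw [iterQuot, constantCoeff_comp _ (constantCoeff_iter hf m), constantCoeff_shift]

theorem coeff_one_sub_one_eq {f v w : PowerSeries R} (hf : constantCoeff f = 0) {m : ℕ}
    (hw : v - X = iter f m * w) : coeff 1 v - 1 = coeff 1 f ^ m * constantCoeff w := by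
  rw [← coeff_one_X (R := R), ← map_sub, hw, coeff_one_mul, constantCoeff_iter hf, mul_zero,
    add_zero, coeff_one_iter hf]

end Formal

section ContentDivisibility

variable {R S : Type*} [CommRing R] [CommRing S]

theorem C_dvd_iff (a : R) (g : PowerSeries R) : C a ∣ g ↔ ∀ n, a ∣ coeff n g := by
  constructor
  · rintro ⟨h, rfl⟩ n
    exact ⟨coeff n h, coeff_C_mul n h a⟩
  · intro h
    choose b hb using h
    exact ⟨mk b, by ext n; rw [coeff_C_mul, coeff_mk, hb]⟩

theorem map_eq_zero_iff_C_dvd {φ : R →+* S} {a : R} (hφ : RingHom.ker φ = Ideal.span {a})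
    (g : PowerSeries R) : map φ g = 0 ↔ C a ∣ g := by
  rw [C_dvd_iff, PowerSeries.ext_iff]
  refine forall_congr' fun n => ?_
  rw [coeff_map, map_zero, ← RingHom.mem_ker, hφ, Ideal.mem_span_singleton]

theorem exists_eq_C_pow_mul_not_dvd [IsDomain R] [WfDvdMonoid R] {ϖ : R} (hϖ : ¬ IsUnit ϖ)
    {h : PowerSeries R} (h0 : h ≠ 0) :
    ∃ (c : ℕ) (g : PowerSeries R), h = C ϖ ^ c * g ∧ ¬ C ϖ ∣ g := by
  obtain ⟨k, hk⟩ : ∃ k, coeff k h ≠ 0 := by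
    by_contra! hk
    exact h0 (PowerSeries.ext hk)
  obtain ⟨n, hn⟩ := FiniteMultiplicity.of_not_isUnit hϖ hk
  have hfin : FiniteMultiplicity (C ϖ) h := by
    refine ⟨n, fun hd => hn ?_⟩
    rw [← map_pow] at hd
    exact (C_dvd_iff _ _).mp hd k
  obtain ⟨g, hg⟩ := hfin.exists_eq_pow_mul_and_not_dvd
  exact ⟨_, g, hg⟩

theorem C_dvd_of_C_dvd_comp {ϖ : R} (hϖ : Prime ϖ) {f h : PowerSeries R}
    (hf0 : constantCoeff f = 0) (hf : ¬ C ϖ ∣ f) (hhf : C ϖ ∣ comp h f) : C ϖ ∣ h := by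
  have : (Ideal.span {ϖ}).IsPrime := (Ideal.span_singleton_prime hϖ.ne_zero).mpr hϖ
  have hker := Ideal.mk_ker (I := Ideal.span {ϖ})
  rw [← map_eq_zero_iff_C_dvd hker] at hf hhf ⊢
  rw [map_comp _ _ hf0] at hhf
  refine eq_zero_of_comp_eq_zero ?_ hf hhf
  rw [constantCoeff_map, hf0, map_zero]

theorem not_C_dvd_iter {ϖ : R} (hϖ : Prime ϖ) {f : PowerSeries R} (hf0 : constantCoeff f = 0)
    (hf : ¬ C ϖ ∣ f) (m : ℕ) : ¬ C ϖ ∣ iter f m := by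
  induction m with
  | zero =>
    intro h
    refine hϖ.not_isUnit (isUnit_of_dvd_one ?_)
    simpa [iter] using (C_dvd_iff _ _).mp h 1
  | succ m ih => exact fun h => hf (C_dvd_of_C_dvd_comp hϖ (constantCoeff_iter hf0 m) ih h)

theorem not_C_dvd_iterQuot {ϖ : R} (hϖ : Prime ϖ) {f : PowerSeries R}
    (hf0 : constantCoeff f = 0) (hf : ¬ C ϖ ∣ f) (m : ℕ) : ¬ C ϖ ∣ iterQuot f m := fun h =>
  not_C_dvd_iter hϖ hf0 hf (m + 1) (iter_succ_eq_mul hf0 m ▸ h.mul_left _)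

theorem C_dvd_comp_X_add_sub {a : R} {f e : PowerSeries R} (he : constantCoeff e = 0)
    (he2 : C a ∣ e ^ 2) (hfe : C a ∣ d⁄dX R f * e) : C a ∣ comp f (X + e) - f := by
  have hker := Ideal.mk_ker (I := Ideal.span {a})
  set φ := Ideal.Quotient.mk (Ideal.span {a})
  have hXe : constantCoeff (X + e) = 0 := by rw [map_add, constantCoeff_X, he, add_zero]
  have hφe : constantCoeff (map φ e) = 0 := by rw [constantCoeff_map, he, map_zero]
  rw [← map_eq_zero_iff_C_dvd hker] at he2 hfe ⊢
  rw [map_pow] at he2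
  rw [map_mul, map_derivative] at hfe
  rw [map_sub, map_comp _ _ hXe, map_add, map_X, comp_X_add_of_sq_eq_zero _ hφe he2, hfe,
    add_zero, sub_self]

/-- Modulo the first power of `ϖ` that does not divide `v - X`, the Taylor expansion of
`f ∘ v` is `f`, because `ϖ` divides the derivative, while that of `v ∘ f` is not. -/
theorem eq_X_of_comp_comm [IsDomain R] [WfDvdMonoid R] {ϖ : R} (hϖ : Prime ϖ)
    {f v : PowerSeries R} (hf0 : constantCoeff f = 0) (hf : ¬ C ϖ ∣ f) (hf' : C ϖ ∣ d⁄dX R f)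
    (hv0 : constantCoeff v = 0) (hcomm : comp f v = comp v f) (hv : C ϖ ∣ v - X) : v = X := by
  by_contra hne
  obtain ⟨c, h, hvX, hh⟩ := exists_eq_C_pow_mul_not_dvd hϖ.not_isUnit (sub_ne_zero.mpr hne)
  have hC : (C ϖ : PowerSeries R) ≠ 0 := (map_ne_zero_iff _ C_injective).mpr hϖ.ne_zero
  have hc : c ≠ 0 := by
    rintro rfl
    exact hh (by simpa [hvX] using hv)
  have hh0 : constantCoeff h = 0 := by
    have := congrArg constantCoeff hvX
    simpa [hv0, hϖ.ne_zero] using this.symm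
  have hv_eq : v = X + C ϖ ^ c * h := (add_eq_of_eq_sub' hvX.symm).symm
  have hvf : comp v f - f = C ϖ ^ c * comp h f := by
    rw [hv_eq, comp_add _ _ hf0, comp_mul _ _ hf0, comp_pow _ _ hf0, X_comp hf0, comp_C,
      add_sub_cancel_left]
  have hdvd : C ϖ ^ (c + 1) ∣ C ϖ ^ c * comp h f := by
    rw [← hvf, ← hcomm, hv_eq, ← map_pow]
    refine C_dvd_comp_X_add_sub (by simp [hh0]) ?_ ?_ <;> rw [map_pow]
    · rw [mul_pow, ← pow_mul]
      exact (pow_dvd_pow _ (by omega)).mul_right _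
    · rw [pow_succ', ← mul_assoc]
      exact (mul_dvd_mul_right hf' _).mul_right _
  rw [pow_succ, mul_dvd_mul_iff_left (pow_ne_zero c hC)] at hdvd
  exact hh (C_dvd_of_C_dvd_comp hϖ hf0 hf hdvd)

end ContentDivisibility

theorem summable_of_mem_finiteDimensional {𝕜 E ι : Type*} [NontriviallyNormedField 𝕜]
    [CompleteSpace 𝕜] [NormedAddCommGroup E] [NormedSpace 𝕜 E] (V : Submodule 𝕜 E)
    [FiniteDimensional 𝕜 V] {F : ι → E} (hF : ∀ i, F i ∈ V) (hs : Summable fun i => ‖F i‖) :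
    Summable F := by
  have : CompleteSpace V := FiniteDimensional.complete 𝕜 V
  have h : Summable fun i => (⟨F i, hF i⟩ : V) := Summable.of_norm hs
  exact h.map V.subtype continuous_subtype_val

section Evaluation

variable {p : ℕ} [Fact p.Prime]

theorem algebraMap_padicInt_eq (a : ℤ_[p]) :
    algebraMap ℚ_[p] (PadicAlgCl p) (a : ℚ_[p]) = algebraMap ℤ_[p] (PadicAlgCl p) a :=
  (IsScalarTower.algebraMap_apply ℤ_[p] ℚ_[p] (PadicAlgCl p) a).symm

theorem norm_algebraMap_padicInt (a : ℤ_[p]) :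
    ‖algebraMap ℤ_[p] (PadicAlgCl p) a‖ = ‖a‖ := by
  rw [← algebraMap_padicInt_eq, norm_algebraMap', PadicInt.norm_def]

theorem algebraMap_padicInt_injective :
    Function.Injective (algebraMap ℤ_[p] (PadicAlgCl p)) := by
  rw [injective_iff_map_eq_zero]
  intro a ha
  rw [← norm_eq_zero, ← norm_algebraMap_padicInt, ha, norm_zero]

theorem norm_term_le (a : ℤ_[p]) (x : PadicAlgCl p) (k : ℕ) :
    ‖algebraMap ℤ_[p] (PadicAlgCl p) a * x ^ k‖ ≤ ‖x‖ ^ k := by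
  rw [norm_mul, norm_pow, norm_algebraMap_padicInt]
  exact mul_le_of_le_one_left (by positivity) a.norm_le_one

theorem term_mem_adjoin (a : ℤ_[p]) (x : PadicAlgCl p) (k : ℕ) :
    algebraMap ℤ_[p] (PadicAlgCl p) a * x ^ k ∈ IntermediateField.adjoin ℚ_[p] {x} := by
  rw [← algebraMap_padicInt_eq]
  exact mul_mem (IntermediateField.algebraMap_mem _ _)
    (pow_mem (IntermediateField.mem_adjoin_simple_self _ _) _)

theorem summable_of_mem_adjoin {ι : Type*} {F : ι → PadicAlgCl p} {x : PadicAlgCl p}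
    (hF : ∀ i, F i ∈ IntermediateField.adjoin ℚ_[p] {x}) (hs : Summable fun i => ‖F i‖) :
    Summable F :=
  have : FiniteDimensional ℚ_[p] (IntermediateField.adjoin ℚ_[p] {x}) :=
    IntermediateField.adjoin.finiteDimensional (Algebra.IsIntegral.isIntegral x)
  summable_of_mem_finiteDimensional (IntermediateField.adjoin ℚ_[p] {x}).toSubmodule hF hs

theorem summable_norm_term (g : PowerSeries ℤ_[p]) {x : PadicAlgCl p} (hx : ‖x‖ < 1) :
    Summable fun k => ‖algebraMap ℤ_[p] (PadicAlgCl p) (coeff k g) * x ^ k‖ :=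
  (summable_geometric_of_lt_one (norm_nonneg x) hx).of_nonneg_of_le (fun _ => norm_nonneg _)
    fun k => norm_term_le _ x k

theorem summable_term (g : PowerSeries ℤ_[p]) {x : PadicAlgCl p} (hx : ‖x‖ < 1) :
    Summable fun k => algebraMap ℤ_[p] (PadicAlgCl p) (coeff k g) * x ^ k :=
  summable_of_mem_adjoin (fun k => term_mem_adjoin _ x k) (summable_norm_term g hx)

theorem eval_eq_tsum (g : PowerSeries ℤ_[p]) (x : PadicAlgCl p) :
    eval g x = ∑' k, algebraMap ℤ_[p] (PadicAlgCl p) (coeff k g) * x ^ k := by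
  simp only [eval, algebraMap_padicInt_eq]

theorem eval_mul (g h : PowerSeries ℤ_[p]) {x : PadicAlgCl p} (hx : ‖x‖ < 1) :
    eval (g * h) x = eval g x * eval h x := by
  simp only [eval_eq_tsum]
  rw [(summable_term g hx).tsum_mul_tsum_eq_tsum_sum_antidiagonal (summable_term h hx)]
  · refine tsum_congr fun n => ?_
    rw [coeff_mul, map_sum, Finset.sum_mul]
    refine Finset.sum_congr rfl fun kl hkl => ?_
    rw [← Finset.HasAntidiagonal.mem_antidiagonal.mp hkl, map_mul, pow_add]
    ring
  · have hn := Summable.mul_norm (summable_norm_term g hx) (summable_norm_term h hx)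
    exact summable_of_mem_adjoin
      (fun i => mul_mem (term_mem_adjoin _ x _) (term_mem_adjoin _ x _)) hn

theorem eval_add (g h : PowerSeries ℤ_[p]) {x : PadicAlgCl p} (hx : ‖x‖ < 1) :
    eval (g + h) x = eval g x + eval h x := by
  simp only [eval_eq_tsum]
  rw [← (summable_term g hx).tsum_add (summable_term h hx)]
  exact tsum_congr fun n => by rw [map_add, map_add, add_mul]

theorem eval_monomial (k : ℕ) (a : ℤ_[p]) (x : PadicAlgCl p) :
    eval (monomial k a) x = algebraMap ℤ_[p] (PadicAlgCl p) a * x ^ k := by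
  rw [eval_eq_tsum, tsum_eq_single k]
  · rw [coeff_monomial_same]
  · intro j hj
    rw [coeff_monomial, if_neg hj, map_zero, zero_mul]

theorem eval_C (a : ℤ_[p]) (x : PadicAlgCl p) :
    eval (C a) x = algebraMap ℤ_[p] (PadicAlgCl p) a := by
  simpa using eval_monomial 0 a x

theorem eval_X (x : PadicAlgCl p) : eval (X : PowerSeries ℤ_[p]) x = x := by
  simpa [X_eq] using eval_monomial 1 (1 : ℤ_[p]) x

/-- Evaluation of series over `ℤ_p` at a point of the open unit disc, as an algebra
homomorphism. -/
noncomputable def evalHom (x : PadicAlgCl p) (hx : ‖x‖ < 1) :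
    PowerSeries ℤ_[p] →ₐ[ℤ_[p]] PadicAlgCl p where
  toFun g := eval g x
  map_one' := by simpa using eval_C (1 : ℤ_[p]) x
  map_mul' g h := eval_mul g h hx
  map_zero' := by simpa using eval_C (0 : ℤ_[p]) x
  map_add' g h := eval_add g h hx
  commutes' a := eval_C a x

theorem evalHom_apply (x : PadicAlgCl p) (hx : ‖x‖ < 1) (g : PowerSeries ℤ_[p]) :
    evalHom x hx g = eval g x := rfl

theorem eval_sub (g h : PowerSeries ℤ_[p]) {x : PadicAlgCl p} (hx : ‖x‖ < 1) :
    eval (g - h) x = eval g x - eval h x := map_sub (evalHom x hx) g h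

theorem eval_pow (g : PowerSeries ℤ_[p]) (n : ℕ) {x : PadicAlgCl p} (hx : ‖x‖ < 1) :
    eval (g ^ n) x = eval g x ^ n := map_pow (evalHom x hx) g n

theorem eval_coe (P : Polynomial ℤ_[p]) {x : PadicAlgCl p} (hx : ‖x‖ < 1) :
    eval (P : PowerSeries ℤ_[p]) x = Polynomial.aeval x P := by
  have h : (evalHom x hx).comp (Polynomial.coeToPowerSeries.algHom ℤ_[p]) =
      Polynomial.aeval x := by
    ext
    simp [evalHom_apply, Polynomial.coeToPowerSeries.algHom_apply, eval_X]
  simpa [evalHom_apply, Polynomial.coeToPowerSeries.algHom_apply] using DFunLike.congr_fun h P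

theorem norm_eval_le_one (g : PowerSeries ℤ_[p]) {x : PadicAlgCl p} (hx : ‖x‖ < 1) :
    ‖eval g x‖ ≤ 1 := by
  rw [eval_eq_tsum]
  refine (IsUltrametricDist.norm_tsum_le _).trans (ciSup_le fun k => ?_)
  exact (norm_term_le _ x k).trans (pow_le_one₀ (norm_nonneg x) hx.le)

theorem norm_eval_sub_le (g : PowerSeries ℤ_[p]) {x : PadicAlgCl p} (hx : ‖x‖ < 1) :
    ‖eval g x - algebraMap ℤ_[p] (PadicAlgCl p) (constantCoeff g)‖ ≤ ‖x‖ := by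
  have h := congrArg (fun h => eval h x) (eq_X_mul_shift_add_const g)
  simp only [eval_add _ _ hx, eval_mul _ _ hx, eval_X, eval_C] at h
  rw [h, add_sub_cancel_right, norm_mul]
  exact mul_le_of_le_one_right (norm_nonneg x) (norm_eval_le_one _ hx)

theorem norm_eval_le {g : PowerSeries ℤ_[p]} (hg : constantCoeff g = 0) {x : PadicAlgCl p}
    (hx : ‖x‖ < 1) : ‖eval g x‖ ≤ ‖x‖ := by
  simpa [hg] using norm_eval_sub_le g hx

theorem norm_eval_lt_one {g : PowerSeries ℤ_[p]} (hg : constantCoeff g = 0) {x : PadicAlgCl p}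
    (hx : ‖x‖ < 1) : ‖eval g x‖ < 1 := (norm_eval_le hg hx).trans_lt hx

theorem eval_zero_right (g : PowerSeries ℤ_[p]) :
    eval g 0 = algebraMap ℤ_[p] (PadicAlgCl p) (constantCoeff g) := by
  simpa [sub_eq_zero] using norm_eval_sub_le g (x := 0) (by simp)

theorem eval_ne_zero_of_isUnit {g : PowerSeries ℤ_[p]} (hg : IsUnit g) {x : PadicAlgCl p}
    (hx : ‖x‖ < 1) : eval g x ≠ 0 :=
  (hg.map (evalHom x hx)).ne_zero

theorem eval_comp (g : PowerSeries ℤ_[p]) {h : PowerSeries ℤ_[p]} (hh : constantCoeff h = 0)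
    {x : PadicAlgCl p} (hx : ‖x‖ < 1) : eval (comp g h) x = eval g (eval h x) := by
  have hy : ‖eval h x‖ < 1 := norm_eval_lt_one hh hx
  set y := eval h x
  have hbound : ∀ N : ℕ, ‖eval (comp g h) x - eval g y‖ ≤ ‖y‖ ^ N := by
    intro N
    set r : PowerSeries ℤ_[p] := mk fun i => coeff (i + N) g
    have hg : g = X ^ N * r + (trunc N g : PowerSeries ℤ_[p]) := eq_X_pow_mul_shift_add_trunc N g
    have htrunc : eval (Polynomial.aeval h (trunc N g)) x = Polynomial.aeval y (trunc N g) := by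
      rw [← evalHom_apply x hx, ← Polynomial.aeval_algHom_apply, evalHom_apply]
    have hcomp : eval (comp g h) x =
        y ^ N * eval (comp r h) x + Polynomial.aeval y (trunc N g) := by
      conv_lhs => rw [hg]
      rw [comp_add _ _ hh, comp_mul _ _ hh, comp_pow _ _ hh, X_comp hh, comp_coe _ hh,
        eval_add _ _ hx, eval_mul _ _ hx, eval_pow _ _ hx, htrunc]
    have heval : eval g y = y ^ N * eval r y + Polynomial.aeval y (trunc N g) := by
      conv_lhs => rw [hg]
      rw [eval_add _ _ hy, eval_mul _ _ hy, eval_pow _ _ hy, eval_X, eval_coe _ hy]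
    rw [hcomp, heval, add_sub_add_right_eq_sub, ← mul_sub, norm_mul, norm_pow]
    refine mul_le_of_le_one_right (by positivity) ?_
    rw [sub_eq_add_neg]
    refine (IsUltrametricDist.norm_add_le_max _ _).trans (max_le (norm_eval_le_one _ hx) ?_)
    rw [norm_neg]
    exact norm_eval_le_one _ hy
  have hzero := ge_of_tendsto' (tendsto_pow_atTop_nhds_zero_of_lt_one (norm_nonneg y) hy) hbound
  exact sub_eq_zero.mp (norm_eq_zero.mp (le_antisymm hzero (norm_nonneg _)))

end Evaluation

section Zeros

variable {p : ℕ} [Fact p.Prime]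

theorem map_residue_eq_zero_iff (h : PowerSeries ℤ_[p]) :
    map (IsLocalRing.residue ℤ_[p]) h = 0 ↔ C (p : ℤ_[p]) ∣ h :=
  map_eq_zero_iff_C_dvd (by rw [IsLocalRing.ker_residue, PadicInt.maximalIdeal_eq_span_p]) h

theorem norm_lt_one_of_aeval_eq_zero {D : Polynomial ℤ_[p]}
    (hD : D.IsDistinguishedAt (IsLocalRing.maximalIdeal ℤ_[p])) {x : PadicAlgCl p}
    (hx : Polynomial.aeval x D = 0) : ‖x‖ < 1 := by
  by_contra! h1
  rw [Polynomial.aeval_eq_sum_range, Finset.sum_range_succ, hD.monic.coeff_natDegree, one_smul,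
    add_comm, add_eq_zero_iff_eq_neg] at hx
  have hpow : ‖x ^ D.natDegree‖ ≤ ‖(p : ℤ_[p])‖ * ‖x‖ ^ D.natDegree := by
    rw [hx, norm_neg]
    refine IsUltrametricDist.norm_sum_le_of_forall_le_of_nonneg (by positivity) fun i hi => ?_
    have hi' := Finset.mem_range.mp hi
    obtain ⟨b, hb⟩ : (p : ℤ_[p]) ∣ D.coeff i := by
      rw [← Ideal.mem_span_singleton, ← PadicInt.maximalIdeal_eq_span_p]
      exact hD.mem hi'
    rw [Algebra.smul_def, norm_mul, norm_algebraMap_padicInt, norm_pow, hb, norm_mul]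
    exact mul_le_mul (mul_le_of_le_one_right (norm_nonneg _) b.norm_le_one)
      (pow_le_pow_right₀ h1 hi'.le) (by positivity) (norm_nonneg _)
  have hp : ‖(p : ℤ_[p])‖ < 1 := PadicInt.not_isUnit_iff.mp PadicInt.prime_p.not_isUnit
  have hpos : 0 < ‖x‖ ^ D.natDegree := by positivity
  rw [norm_pow] at hpow
  nlinarith

theorem eval_eq_zero_iff_aeval_eq_zero {q U : PowerSeries ℤ_[p]} {P : Polynomial ℤ_[p]}
    (H : q.IsWeierstrassFactorization P U) {x : PadicAlgCl p} (hx : ‖x‖ < 1) :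
    eval q x = 0 ↔ Polynomial.aeval x P = 0 := by
  rw [H.eq_mul, eval_mul _ _ hx, eval_coe _ hx, mul_eq_zero,
    or_iff_left (eval_ne_zero_of_isUnit H.isUnit hx)]

theorem exists_eval_eq_zero_of_not_isUnit {w : PowerSeries ℤ_[p]} (hw : ¬ C (p : ℤ_[p]) ∣ w)
    (hunit : ¬ IsUnit w) : ∃ x : PadicAlgCl p, ‖x‖ < 1 ∧ eval w x = 0 := by
  rw [← map_residue_eq_zero_iff] at hw
  obtain ⟨P, U, H⟩ := exists_isWeierstrassFactorization hw
  have hdeg : P.natDegree ≠ 0 := by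
    intro h
    rw [H.eq_mul, Polynomial.eq_one_of_monic_natDegree_zero H.isDistinguishedAt.monic h,
      Polynomial.coe_one, one_mul] at hunit
    exact hunit H.isUnit
  obtain ⟨x, hx⟩ := IsAlgClosed.exists_aeval_eq_zero_of_injective (PadicAlgCl p)
    algebraMap_padicInt_injective P
    (fun h => hdeg (Polynomial.natDegree_eq_of_degree_eq_some h))
  have hx1 := norm_lt_one_of_aeval_eq_zero H.isDistinguishedAt hx
  exact ⟨x, hx1, (eval_eq_zero_iff_aeval_eq_zero H hx1).mpr hx⟩

theorem finite_zeros {h : PowerSeries ℤ_[p]} (h0 : h ≠ 0) :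
    {x : PadicAlgCl p | ‖x‖ < 1 ∧ eval h x = 0}.Finite := by
  obtain ⟨c, g, rfl, hg⟩ := exists_eq_C_pow_mul_not_dvd PadicInt.prime_p.not_isUnit h0
  rw [← map_residue_eq_zero_iff] at hg
  obtain ⟨P, U, H⟩ := exists_isWeierstrassFactorization hg
  refine (Polynomial.rootSet_finite (P.map (algebraMap ℤ_[p] ℚ_[p])) (PadicAlgCl p)).subset ?_
  rintro x ⟨hx, hgx⟩
  have hp : algebraMap ℤ_[p] (PadicAlgCl p) p ≠ 0 :=
    (map_ne_zero_iff _ algebraMap_padicInt_injective).mpr PadicInt.prime_p.ne_zero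
  rw [eval_mul _ _ hx, eval_pow _ _ hx, eval_C, mul_eq_zero, or_iff_right (pow_ne_zero c hp),
    eval_eq_zero_iff_aeval_eq_zero H hx] at hgx
  rw [Polynomial.mem_rootSet_of_ne (H.isDistinguishedAt.monic.map _).ne_zero,
    Polynomial.aeval_map_algebraMap, hgx]

/-- Series over a local ring whose Weierstrass polynomial is Eisenstein at the maximal ideal. -/
structure IsEisensteinSeries {R : Type*} [CommRing R] [IsLocalRing R] (q : PowerSeries R) :
    Prop where
  map_residue_ne_zero : map (IsLocalRing.residue R) q ≠ 0
  mem_maximalIdeal : constantCoeff q ∈ IsLocalRing.maximalIdeal R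
  notMem_sq : constantCoeff q ∉ IsLocalRing.maximalIdeal R ^ 2

namespace IsEisensteinSeries

theorem irreducible {R : Type*} [CommRing R] [IsDomain R] [IsLocalRing R] {q U : PowerSeries R}
    {P : Polynomial R} (hq : IsEisensteinSeries q) (H : q.IsWeierstrassFactorization P U) :
    Irreducible P := by
  have hP := H.isDistinguishedAt
  have hprime : (IsLocalRing.maximalIdeal R).IsPrime := inferInstance
  have hconst : constantCoeff q = P.coeff 0 * constantCoeff U := by
    rw [H.eq_mul, map_mul, Polynomial.constantCoeff_coe]
  have hnotMem : P.coeff 0 ∉ IsLocalRing.maximalIdeal R ^ 2 := fun h =>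
    hq.notMem_sq (hconst ▸ Ideal.mul_mem_right _ _ h)
  have hdeg : 0 < P.natDegree := by
    refine Nat.pos_of_ne_zero fun h => (IsLocalRing.mem_maximalIdeal _).mp hq.mem_maximalIdeal ?_
    rw [hconst, Polynomial.eq_one_of_monic_natDegree_zero hP.monic h, Polynomial.coeff_one_zero,
      one_mul]
    exact H.isUnit.map constantCoeff
  refine Polynomial.IsEisensteinAt.irreducible (𝓟 := IsLocalRing.maximalIdeal R)
    ⟨?_, fun h => hP.mem h, hnotMem⟩ hprime hP.monic.isPrimitive hdeg
  rw [hP.monic.leadingCoeff]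
  exact (Ideal.ne_top_iff_one _).mp hprime.ne_top

variable {q : PowerSeries ℤ_[p]}

theorem irreducible_map (hq : IsEisensteinSeries q) {P : Polynomial ℤ_[p]} {U : PowerSeries ℤ_[p]}
    (H : q.IsWeierstrassFactorization P U) : Irreducible (P.map (algebraMap ℤ_[p] ℚ_[p])) :=
  H.isDistinguishedAt.monic.irreducible_iff_irreducible_map_fraction_map.mp (hq.irreducible H)

theorem dvd_of_eval_eq_zero (hq : IsEisensteinSeries q) {x : PadicAlgCl p} (hx : ‖x‖ < 1)
    (hqx : eval q x = 0) {h : PowerSeries ℤ_[p]} (hhx : eval h x = 0) : q ∣ h := by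
  obtain ⟨P, U, H⟩ := exists_isWeierstrassFactorization hq.map_residue_ne_zero
  obtain ⟨s, r, hsr⟩ := exists_isWeierstrassDivision h hq.map_residue_ne_zero
  have hP := H.isDistinguishedAt.monic
  have hmin : P.map (algebraMap ℤ_[p] ℚ_[p]) = minpoly ℚ_[p] x := by
    refine minpoly.eq_of_irreducible_of_monic (hq.irreducible_map H) ?_ (hP.map _)
    rw [Polynomial.aeval_map_algebraMap, (eval_eq_zero_iff_aeval_eq_zero H hx).mp hqx]
  have hdeg : r.degree < P.degree := by
    rw [Polynomial.degree_eq_natDegree hP.ne_zero, H.natDegree_eq_toNat_order_map]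
    exact hsr.degree_lt
  have hrx : Polynomial.aeval x r = 0 := by
    rw [← eval_coe _ hx, ← hhx, hsr.eq_mul_add, eval_add _ _ hx, eval_mul _ _ hx, hqx, zero_mul,
      zero_add]
  have hr_map : r.map (algebraMap ℤ_[p] ℚ_[p]) = 0 := by
    refine Polynomial.eq_zero_of_dvd_of_degree_lt (p := P.map (algebraMap ℤ_[p] ℚ_[p])) ?_ ?_
    · rw [hmin]
      exact minpoly.dvd _ _ (by rw [Polynomial.aeval_map_algebraMap, hrx])
    · rw [hP.degree_map]
      exact Polynomial.degree_map_le.trans_lt hdeg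
  have hr : r = 0 :=
    (Polynomial.map_eq_zero_iff (FaithfulSMul.algebraMap_injective ℤ_[p] ℚ_[p])).mp hr_map
  exact ⟨s, by rw [hsr.eq_mul_add, hr, Polynomial.coe_zero, add_zero]⟩

theorem eval_derivative_ne_zero (hq : IsEisensteinSeries q) {x : PadicAlgCl p} (hx : ‖x‖ < 1)
    (hqx : eval q x = 0) : eval (d⁄dX ℤ_[p] q) x ≠ 0 := by
  obtain ⟨P, U, H⟩ := exists_isWeierstrassFactorization hq.map_residue_ne_zero
  have hPx := (eval_eq_zero_iff_aeval_eq_zero H hx).mp hqx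
  have hsep := (hq.irreducible_map H).separable.aeval_derivative_ne_zero (x := x)
    (by rw [Polynomial.aeval_map_algebraMap, hPx])
  rw [Polynomial.derivative_map, Polynomial.aeval_map_algebraMap] at hsep
  have hderiv : eval (d⁄dX ℤ_[p] q) x =
      Polynomial.aeval x (Polynomial.derivative P) * eval U x := by
    rw [H.eq_mul, Derivation.leibniz, smul_eq_mul, smul_eq_mul, eval_add _ _ hx, eval_mul _ _ hx,
      eval_mul _ _ hx, eval_coe _ hx, hPx, derivative_coe, eval_coe _ hx]
    ring
  rw [hderiv]
  exact mul_ne_zero hsep (eval_ne_zero_of_isUnit H.isUnit hx)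

end IsEisensteinSeries

end Zeros

section LiftingTheExponent

theorem one_le_delta (p : ℕ) : 1 ≤ delta p := by
  unfold delta
  split_ifs <;> decide

variable {R : Type*} [CommRing R] {p : ℕ} {a : R}

theorem dvd_sub_one_of_pow_delta_dvd (ha : (p : R) ^ delta p ∣ a - 1) : (p : R) ∣ a - 1 :=
  (dvd_pow_self _ (Nat.one_le_iff_ne_zero.mp (one_le_delta p))).trans ha

theorem not_dvd_of_dvd_sub_one {ϖ : R} (hϖ : ¬ IsUnit ϖ) (ha : ϖ ∣ a - 1) : ¬ ϖ ∣ a := fun h =>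
  hϖ (isUnit_of_dvd_one (by simpa using dvd_sub h ha))

theorem emultiplicity_two_add_one [IsDomain R] (h2 : Prime (2 : R)) (ha : (2 : R) ^ 2 ∣ a - 1) :
    emultiplicity (2 : R) (a + 1) = 1 := by
  obtain ⟨b, hb⟩ := ha
  have hab : a + 1 = 2 * (1 + 2 * b) := by linear_combination hb
  have hodd : ¬ (2 : R) ∣ 1 + 2 * b := not_dvd_of_dvd_sub_one h2.not_isUnit ⟨b, by ring⟩
  refine (emultiplicity_eq_coe (n := 1)).mpr ?_
  rw [hab, pow_one, pow_two, mul_dvd_mul_iff_left h2.ne_zero]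
  exact ⟨dvd_mul_right _ _, hodd⟩

theorem emultiplicity_pow_prime_sub_one [IsDomain R] (hp : p.Prime) (hpR : Prime (p : R))
    (ha : (p : R) ^ delta p ∣ a - 1) :
    emultiplicity (p : R) (a ^ p - 1) = emultiplicity (p : R) (a - 1) + 1 := by
  rcases hp.eq_two_or_odd' with rfl | hodd
  · rw [Nat.cast_ofNat] at hpR ⊢
    rw [show a ^ 2 - 1 = (a - 1) * (a + 1) by ring, emultiplicity_mul hpR,
      emultiplicity_two_add_one hpR (by simpa [delta] using ha)]
  · have hdvd := dvd_sub_one_of_pow_delta_dvd ha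
    simpa only [one_pow] using emultiplicity_pow_prime_sub_pow_prime hpR hodd hdvd
      (not_dvd_of_dvd_sub_one hpR.not_isUnit hdvd)

theorem emultiplicity_pow_sub_one [IsDomain R] (hp : p.Prime) (hpR : Prime (p : R))
    (ha : (p : R) ^ delta p ∣ a - 1) (k : ℕ) {m : ℕ} (hm : ¬ (p : R) ∣ m) :
    emultiplicity (p : R) (a ^ (p ^ k * m) - 1) = emultiplicity (p : R) (a - 1) + k := by
  induction k generalizing a with
  | zero =>
    have hdvd := dvd_sub_one_of_pow_delta_dvd ha
    simpa using
      emultiplicity_pow_sub_pow_of_prime hpR hdvd (not_dvd_of_dvd_sub_one hpR.not_isUnit hdvd) hm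
  | succ k ih =>
    have ha' : (p : R) ^ delta p ∣ a ^ p - 1 := ha.trans (sub_one_dvd_pow_sub_one a p)
    rw [pow_succ', mul_assoc, pow_mul, ih ha', emultiplicity_pow_prime_sub_one hp hpR ha,
      add_assoc, Nat.cast_succ, add_comm 1]

end LiftingTheExponent

section Valuation

variable {p : ℕ} [Fact p.Prime]

theorem mem_maximalIdeal_pow_iff {x : ℤ_[p]} (hx : x ≠ 0) (n : ℕ) :
    x ∈ IsLocalRing.maximalIdeal ℤ_[p] ^ n ↔ n ≤ x.valuation := by
  rw [PadicInt.maximalIdeal_eq_span_p, Ideal.span_singleton_pow,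
    PadicInt.mem_span_pow_iff_le_valuation x hx]

theorem emultiplicity_p_eq_valuation {x : ℤ_[p]} (hx : x ≠ 0) :
    emultiplicity (p : ℤ_[p]) x = x.valuation := by
  simp only [emultiplicity_eq_coe, ← Ideal.mem_span_singleton,
    PadicInt.mem_span_pow_iff_le_valuation x hx]
  omega

theorem isUnit_iff_valuation_eq_zero {x : ℤ_[p]} (hx : x ≠ 0) :
    IsUnit x ↔ x.valuation = 0 := by
  rw [← not_iff_not, ← mem_nonunits_iff, ← IsLocalRing.mem_maximalIdeal,
    ← pow_one (IsLocalRing.maximalIdeal ℤ_[p]), mem_maximalIdeal_pow_iff hx]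
  omega

theorem ne_zero_of_valuation_ne_zero {x : ℤ_[p]} (hx : x.valuation ≠ 0) : x ≠ 0 := by
  rintro rfl
  exact hx PadicInt.valuation_zero

variable {a : ℤ_[p]} {d : ℕ}

theorem sub_one_ne_zero_of_delta_le (ha : delta p ≤ (a - 1).valuation) : a - 1 ≠ 0 :=
  ne_zero_of_valuation_ne_zero (Nat.one_le_iff_ne_zero.mp ((one_le_delta p).trans ha))

theorem pow_delta_dvd_sub_one (ha : delta p ≤ (a - 1).valuation) :
    (p : ℤ_[p]) ^ delta p ∣ a - 1 := by
  rwa [← Ideal.mem_span_singleton,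
    PadicInt.mem_span_pow_iff_le_valuation _ (sub_one_ne_zero_of_delta_le ha)]

theorem isUnit_of_delta_le (ha : delta p ≤ (a - 1).valuation) : IsUnit a := by
  have hndvd := not_dvd_of_dvd_sub_one PadicInt.prime_p.not_isUnit
    (dvd_sub_one_of_pow_delta_dvd (pow_delta_dvd_sub_one ha))
  rwa [← PadicInt.norm_lt_one_iff_dvd, ← PadicInt.not_isUnit_iff, not_not] at hndvd

theorem emultiplicity_p_pow_sub_one (ha : delta p ≤ (a - 1).valuation) (hd : d ≠ 0) :
    emultiplicity (p : ℤ_[p]) (a ^ d - 1) = ((a - 1).valuation + padicValNat p d : ℕ) := by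
  have hp : p.Prime := Fact.out
  obtain ⟨k, m, hm, rfl⟩ := Nat.exists_eq_pow_mul_and_not_dvd hd p hp.ne_one
  have hm' : ¬ (p : ℤ_[p]) ∣ m := by
    rwa [← PadicInt.norm_lt_one_iff_dvd, PadicInt.norm_natCast_lt_one_iff]
  rw [emultiplicity_pow_sub_one hp PadicInt.prime_p (pow_delta_dvd_sub_one ha) k hm',
    emultiplicity_p_eq_valuation (sub_one_ne_zero_of_delta_le ha),
    padicValNat.mul (pow_ne_zero _ hp.ne_zero) (right_ne_zero_of_mul hd), padicValNat.prime_pow,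
    padicValNat.eq_zero_of_not_dvd hm, add_zero, Nat.cast_add]

theorem pow_ne_one_of_delta_le (ha : delta p ≤ (a - 1).valuation) (hd : d ≠ 0) : a ^ d ≠ 1 := by
  intro h
  have := emultiplicity_p_pow_sub_one ha hd
  rw [h, sub_self, emultiplicity_zero] at this
  exact ENat.natCast_ne_top _ this.symm

theorem valuation_pow_sub_one (ha : delta p ≤ (a - 1).valuation) (hd : d ≠ 0) :
    (a ^ d - 1).valuation = (a - 1).valuation + padicValNat p d := by
  have := emultiplicity_p_pow_sub_one ha hd
  rw [emultiplicity_p_eq_valuation (sub_ne_zero.mpr (pow_ne_one_of_delta_le ha hd))] at this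
  exact_mod_cast this

end Valuation

section Dynamics

variable {p : ℕ} [Fact p.Prime] {f g u v w : PowerSeries ℤ_[p]} {x : PadicAlgCl p}

theorem eq_zero_of_eval_eq_zero (hw : constantCoeff w = 0) (hx : ‖x‖ < ‖coeff 1 w‖)
    (hwx : eval w x = 0) : x = 0 := by
  have hx1 : ‖x‖ < 1 := hx.trans_le (PadicInt.norm_le_one _)
  rw [← X_mul_shift hw, eval_mul _ _ hx1, eval_X, mul_eq_zero] at hwx
  refine hwx.resolve_right fun h => hx.not_ge ?_
  simpa [h, norm_algebraMap_padicInt, constantCoeff_shift] using norm_eval_sub_le (shift w) hx1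

theorem eval_eq_zero_iff_of_isUnit (hu : constantCoeff u = 0) (hunit : IsUnit (coeff 1 u))
    (hx : ‖x‖ < 1) : eval u x = 0 ↔ x = 0 := by
  refine ⟨eq_zero_of_eval_eq_zero hu (by rwa [PadicInt.isUnit_iff.mp hunit]), ?_⟩
  rintro rfl
  rw [eval_zero_right, hu, map_zero]

theorem eval_sub_self_eq (hw : v - X = g * w) (hx : ‖x‖ < 1) :
    eval v x - x = eval g x * eval w x := by
  rw [← eval_mul _ _ hx, ← hw, eval_sub _ _ hx, eval_X]

theorem eval_comm (hf : constantCoeff f = 0) (hg : constantCoeff g = 0)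
    (hcomm : comp f g = comp g f) (hx : ‖x‖ < 1) : eval f (eval g x) = eval g (eval f x) := by
  rw [← eval_comp _ hg hx, hcomm, eval_comp _ hf hx]

theorem eval_iter_add (hg : constantCoeff g = 0) (m n : ℕ) (hx : ‖x‖ < 1) :
    eval (iter g (m + n)) x = eval (iter g m) (eval (iter g n) x) := by
  rw [iter_add hg, eval_comp _ (constantCoeff_iter hg n) hx]

theorem eval_iter_eq_zero_of_le (hf : constantCoeff f = 0) {m n : ℕ} (hmn : m ≤ n)
    (hx : ‖x‖ < 1) (h : eval (iter f m) x = 0) : eval (iter f n) x = 0 := by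
  obtain ⟨k, rfl⟩ := Nat.exists_eq_add_of_le' hmn
  rw [eval_iter_add hf _ _ hx, h, eval_zero_right, constantCoeff_iter hf, map_zero]

theorem eval_iter_eval_eq_zero_iff (hf : constantCoeff f = 0) (hv : constantCoeff v = 0)
    (hunit : IsUnit (coeff 1 v)) (hcomm : comp f v = comp v f) (m : ℕ) (hx : ‖x‖ < 1) :
    eval (iter f m) (eval v x) = 0 ↔ eval (iter f m) x = 0 := by
  have hm := constantCoeff_iter hf m
  rw [← eval_comm hv hm (comp_iter_comm hv hf hcomm.symm m) hx,
    eval_eq_zero_iff_of_isUnit hv hunit (norm_eval_lt_one hm hx)]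

theorem eval_iter_eq_zero_iff_of_mem_newRootSet (hf : constantCoeff f = 0) {n : ℕ}
    (hx : x ∈ newRootSet f (n + 1)) (m : ℕ) : eval (iter f m) x = 0 ↔ n + 1 ≤ m := by
  obtain ⟨⟨hx1, hroot⟩, hnew⟩ := hx
  refine ⟨fun h => ?_, fun h => eval_iter_eq_zero_of_le hf h hx1 hroot⟩
  by_contra! hlt
  exact hnew ⟨hx1, eval_iter_eq_zero_of_le hf (Nat.lt_succ_iff.mp hlt) hx1 h⟩

theorem exists_eval_iterQuot_eq_zero (hf : constantCoeff f = 0) (hx : ‖x‖ < 1) {M : ℕ}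
    (hM : eval (iter f M) x ≠ 0) (hex : ∃ m, eval (iter f m) x = 0) :
    ∃ k, eval (iter f M) (eval (iter f k) x) ≠ 0 ∧
      eval (iterQuot f M) (eval (iter f k) x) = 0 := by
  classical
  have hlt : M < Nat.find hex := by
    by_contra! hle
    exact hM (eval_iter_eq_zero_of_le hf hle hx (Nat.find_spec hex))
  obtain ⟨k, hk⟩ := Nat.exists_eq_add_of_le hlt
  have hMk : eval (iter f M) (eval (iter f k) x) ≠ 0 := by
    rw [← eval_iter_add hf _ _ hx]
    exact Nat.find_min hex (by omega)
  have hMk' : eval (iter f (M + 1)) (eval (iter f k) x) = 0 := by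
    rw [← eval_iter_add hf _ _ hx, ← Nat.succ_eq_add_one, ← hk]
    exact Nat.find_spec hex
  rw [iter_succ_eq_mul hf, eval_mul _ _ (norm_eval_lt_one (constantCoeff_iter hf k) hx)] at hMk'
  exact ⟨k, hMk, (mul_eq_zero.mp hMk').resolve_left hMk⟩

theorem norm_eval_le_max_mul (hf : constantCoeff f = 0) (hx : ‖x‖ < 1) :
    ‖eval f x‖ ≤ max ‖x‖ ‖coeff 1 f‖ * ‖x‖ := by
  have hshift := norm_eval_sub_le (shift f) hx
  rw [constantCoeff_shift] at hshift
  rw [← X_mul_shift hf, eval_mul _ _ hx, eval_X, norm_mul, mul_comm, X_mul_shift hf]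
  refine mul_le_mul_of_nonneg_right ?_ (norm_nonneg x)
  rw [← sub_add_cancel (eval (shift f) x) (algebraMap ℤ_[p] (PadicAlgCl p) (coeff 1 f)),
    ← norm_algebraMap_padicInt (coeff 1 f)]
  exact (IsUltrametricDist.norm_add_le_max _ _).trans (max_le_max_right _ hshift)

theorem tendsto_norm_eval_iter (hf : constantCoeff f = 0) (hf1 : ‖coeff 1 f‖ < 1)
    (hx : ‖x‖ < 1) :
    Filter.Tendsto (fun m => ‖eval (iter f m) x‖) Filter.atTop (nhds 0) := by
  set ρ := max ‖x‖ ‖coeff 1 f‖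
  have hρ0 : 0 ≤ ρ := (norm_nonneg x).trans (le_max_left _ _)
  have hbound : ∀ m, ‖eval (iter f m) x‖ ≤ ρ ^ m := by
    intro m
    induction m with
    | zero => rw [iter, eval_X, pow_zero]; exact hx.le
    | succ m ih =>
      have hm := constantCoeff_iter hf m
      rw [iter, eval_comp _ hm hx, pow_succ']
      refine (norm_eval_le_max_mul hf (norm_eval_lt_one hm hx)).trans ?_
      exact mul_le_mul (max_le_max_right _ (norm_eval_le hm hx)) ih (norm_nonneg _) hρ0
  exact squeeze_zero (fun _ => norm_nonneg _) hbound
    (tendsto_pow_atTop_nhds_zero_of_lt_one hρ0 (max_lt hx hf1))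

theorem exists_eval_iter_eq_zero_of_fixed (hf : constantCoeff f = 0) (hf1 : ‖coeff 1 f‖ < 1)
    (hv : constantCoeff v = 0) (hv1 : coeff 1 v ≠ 1) (hcomm : comp f v = comp v f)
    (hx : ‖x‖ < 1) (hfix : eval v x = x) : ∃ m, eval (iter f m) x = 0 := by
  have hpos : 0 < ‖coeff 1 (v - X)‖ := by
    rwa [norm_pos_iff, map_sub, coeff_one_X, sub_ne_zero]
  obtain ⟨m, hm⟩ := ((tendsto_norm_eval_iter hf hf1 hx).eventually (gt_mem_nhds hpos)).exists
  refine ⟨m, eq_zero_of_eval_eq_zero (w := v - X) (by simp [hv]) hm ?_⟩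
  have hfm := constantCoeff_iter hf m
  rw [eval_sub _ _ (norm_eval_lt_one hfm hx), eval_X,
    eval_comm hv hfm (comp_iter_comm hv hf hcomm.symm m) hx, hfix, sub_self]

theorem eval_derivative_eq_of_fixed (hg : constantCoeff g = 0) (hv : constantCoeff v = 0)
    (hcomm : comp g v = comp v g) (hx : ‖x‖ < 1) (hgx : eval g x = 0) (hfix : eval v x = x)
    (hsimple : eval (d⁄dX ℤ_[p] g) x ≠ 0) :
    eval (d⁄dX ℤ_[p] v) x = algebraMap ℤ_[p] (PadicAlgCl p) (coeff 1 v) := by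
  have h := congrArg (fun k => eval (d⁄dX ℤ_[p] k) x) hcomm
  simp only [derivative_comp _ hg, derivative_comp _ hv, eval_mul _ _ hx, eval_comp _ hg hx,
    eval_comp _ hv hx, hfix, hgx, eval_zero_right, constantCoeff_derivative] at h
  exact mul_left_cancel₀ hsimple (h.trans (mul_comm _ _))

theorem eval_derivative_eval_eq_zero (hf : constantCoeff f = 0) (hu : constantCoeff u = 0)
    (hunit : IsUnit (coeff 1 u)) (hcomm : comp f u = comp u f) (hx : ‖x‖ < 1)
    (h : eval (d⁄dX ℤ_[p] f) x = 0) : eval (d⁄dX ℤ_[p] f) (eval u x) = 0 := by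
  have hder := congrArg (fun k => eval (d⁄dX ℤ_[p] k) x) hcomm
  simp only [derivative_comp _ hf, derivative_comp _ hu, eval_mul _ _ hx, eval_comp _ hu hx, h,
    mul_zero] at hder
  refine (mul_eq_zero.mp hder).resolve_right (eval_ne_zero_of_isUnit ?_ hx)
  rwa [isUnit_iff_constantCoeff, constantCoeff_derivative]

theorem exists_periodic_of_finite (hu : constantCoeff u = 0) {Z : Set (PadicAlgCl p)}
    (hZ : Z.Finite) (hZ1 : ∀ y ∈ Z, ‖y‖ < 1) (hmaps : ∀ y ∈ Z, eval u y ∈ Z) (hx : x ∈ Z) :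
    ∃ y ∈ Z, ∃ d, d ≠ 0 ∧ eval (iter u d) y = y := by
  have horbit : ∀ i, eval (iter u i) x ∈ Z := by
    intro i
    induction i with
    | zero => rwa [iter, eval_X]
    | succ i ih =>
      rw [iter, eval_comp _ (constantCoeff_iter hu i) (hZ1 x hx)]
      exact hmaps _ ih
  obtain ⟨i, j, hij, heq⟩ := hZ.exists_lt_map_eq_of_forall_mem horbit
  refine ⟨_, horbit i, j - i, Nat.sub_ne_zero_of_lt hij, ?_⟩
  rw [← eval_iter_add hu _ _ (hZ1 x hx), Nat.sub_add_cancel hij.le, heq]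

end Dynamics

/-- Series over `ℤ_p` without constant term, of finite Weierstrass degree, whose linear coefficient
is a uniformizer. -/
structure IsUniformizerSeries {p : ℕ} [Fact p.Prime] (f : PowerSeries ℤ_[p]) : Prop where
  constantCoeff_eq_zero : constantCoeff f = 0
  not_C_dvd : ¬ C (p : ℤ_[p]) ∣ f
  valuation_coeff_one : (coeff 1 f).valuation = 1

namespace IsUniformizerSeries

variable {p : ℕ} [Fact p.Prime] {f u v w : PowerSeries ℤ_[p]} {x : PadicAlgCl p}

theorem coeff_one_ne_zero (hf : IsUniformizerSeries f) : coeff 1 f ≠ 0 :=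
  ne_zero_of_valuation_ne_zero (by rw [hf.valuation_coeff_one]; decide)

theorem isEisensteinSeries_iterQuot (hf : IsUniformizerSeries f) (m : ℕ) :
    IsEisensteinSeries (iterQuot f m) where
  map_residue_ne_zero := (map_residue_eq_zero_iff _).not.mpr
    (not_C_dvd_iterQuot PadicInt.prime_p hf.constantCoeff_eq_zero hf.not_C_dvd m)
  mem_maximalIdeal := by
    rw [constantCoeff_iterQuot hf.constantCoeff_eq_zero,
      ← pow_one (IsLocalRing.maximalIdeal ℤ_[p]),
      mem_maximalIdeal_pow_iff hf.coeff_one_ne_zero, hf.valuation_coeff_one]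
  notMem_sq := by
    rw [constantCoeff_iterQuot hf.constantCoeff_eq_zero,
      mem_maximalIdeal_pow_iff hf.coeff_one_ne_zero, hf.valuation_coeff_one]
    decide

theorem not_isUnit_coeff_one (hf : IsUniformizerSeries f) : ¬ IsUnit (coeff 1 f) := by
  rw [isUnit_iff_valuation_eq_zero hf.coeff_one_ne_zero, hf.valuation_coeff_one]
  decide

theorem exists_eval_iter_eq_zero (hf : IsUniformizerSeries f) (hv : constantCoeff v = 0)
    (hv1 : coeff 1 v ≠ 1) (hcomm : comp f v = comp v f) (hx : ‖x‖ < 1) (hfix : eval v x = x) :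
    ∃ m, eval (iter f m) x = 0 :=
  exists_eval_iter_eq_zero_of_fixed hf.constantCoeff_eq_zero
    (PadicInt.not_isUnit_iff.mp hf.not_isUnit_coeff_one) hv hv1 hcomm hx hfix

theorem eval_derivative_iter_ne_zero (hf : IsUniformizerSeries f) (m : ℕ) (hx : ‖x‖ < 1)
    (h : eval (iter f m) x = 0) : eval (d⁄dX ℤ_[p] (iter f m)) x ≠ 0 := by
  have hf0 := hf.constantCoeff_eq_zero
  induction m with
  | zero => simpa [iter] using eval_ne_zero_of_isUnit (isUnit_one (M := PowerSeries ℤ_[p])) hx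
  | succ m ih =>
    rw [iter_succ_eq_mul hf0, eval_mul _ _ hx] at h
    rw [iter_succ_eq_mul hf0, Derivation.leibniz, smul_eq_mul, smul_eq_mul, eval_add _ _ hx,
      eval_mul _ _ hx, eval_mul _ _ hx]
    by_cases hm : eval (iter f m) x = 0
    · have hq : eval (iterQuot f m) x ≠ 0 := by
        rw [iterQuot, eval_comp _ (constantCoeff_iter hf0 m) hx, hm, eval_zero_right,
          constantCoeff_shift]
        exact (map_ne_zero_iff _ algebraMap_padicInt_injective).mpr hf.coeff_one_ne_zero
      rw [hm, zero_mul, zero_add]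
      exact mul_ne_zero hq (ih hm)
    · have hq := (mul_eq_zero.mp h).resolve_left hm
      rw [hq, zero_mul, add_zero]
      exact mul_ne_zero hm ((hf.isEisensteinSeries_iterQuot m).eval_derivative_ne_zero hx hq)

/-- The zeros of `f'` form a finite `u`-stable set, so one of them is periodic under `u`, hence a
zero of some iterate of `f`; but those zeros are simple. -/
theorem C_p_dvd_derivative (hf : IsUniformizerSeries f) (hu : constantCoeff u = 0)
    (hunit : IsUnit (coeff 1 u)) (hord : ¬ IsOfFinOrder (coeff 1 u))
    (hcomm : comp f u = comp u f) : C (p : ℤ_[p]) ∣ d⁄dX ℤ_[p] f := by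
  have hf0 := hf.constantCoeff_eq_zero
  by_contra hndvd
  obtain ⟨x, hx⟩ := exists_eval_eq_zero_of_not_isUnit hndvd
    (by rw [isUnit_iff_constantCoeff, constantCoeff_derivative]; exact hf.not_isUnit_coeff_one)
  obtain ⟨y, ⟨hy, hyder⟩, d, hd, hfix⟩ := exists_periodic_of_finite hu
    (finite_zeros fun h => hndvd (by rw [h]; exact dvd_zero _)) (fun y hy => hy.1)
    (fun y hy => ⟨norm_eval_lt_one hu hy.1,
      eval_derivative_eval_eq_zero hf0 hu hunit hcomm hy.1 hy.2⟩) hx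
  have hd1 : coeff 1 (iter u d) ≠ 1 := by
    rw [coeff_one_iter hu]
    exact fun h => hord (isOfFinOrder_iff_pow_eq_one.mpr ⟨d, Nat.pos_of_ne_zero hd, h⟩)
  obtain ⟨m, hm⟩ := hf.exists_eval_iter_eq_zero (constantCoeff_iter hu d) hd1
    (comp_iter_comm hf0 hu hcomm d) hy hfix
  refine hf.eval_derivative_iter_ne_zero (m + 1) hy
    (eval_iter_eq_zero_of_le hf0 m.le_succ hy hm) ?_
  rw [iter_add hf0, iter_one, derivative_comp _ hf0, eval_mul _ _ hy, hyder, mul_zero]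

theorem eval_iter_ne_zero_of_sub_X_eq (hf : IsUniformizerSeries f) (hv : constantCoeff v = 0)
    (hv1 : coeff 1 v ≠ 1) (hcomm : comp f v = comp v f) {M : ℕ} (hw : v - X = iter f M * w)
    (hx : ‖x‖ < 1) (hwx : eval w x = 0) : eval (iter f M) x ≠ 0 := by
  have hf0 := hf.constantCoeff_eq_zero
  intro hMx
  have hfix : eval v x = x := by rw [← sub_eq_zero, eval_sub_self_eq hw hx, hwx, mul_zero]
  have hmult : eval (d⁄dX ℤ_[p] v) x = 1 := by
    have := congrArg (fun g => eval (d⁄dX ℤ_[p] g) x) hw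
    simp only [map_sub, Derivation.leibniz, smul_eq_mul, eval_sub _ _ hx, eval_add _ _ hx,
      eval_mul _ _ hx, hMx, hwx, zero_mul, add_zero, derivative_X] at this
    exact (sub_eq_zero.mp this).trans (map_one (evalHom x hx))
  rw [eval_derivative_eq_of_fixed (constantCoeff_iter hf0 M) hv
    (comp_iter_comm hv hf0 hcomm.symm M).symm hx hMx hfix
    (hf.eval_derivative_iter_ne_zero M hx hMx)] at hmult
  exact hv1 (algebraMap_padicInt_injective (hmult.trans (map_one _).symm))

theorem iterQuot_dvd (hf : IsUniformizerSeries f) (hf' : C (p : ℤ_[p]) ∣ d⁄dX ℤ_[p] f)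
    (hv : constantCoeff v = 0) (hv1 : coeff 1 v ≠ 1) (hcomm : comp f v = comp v f) {M : ℕ}
    (hw : v - X = iter f M * w) (hunit : ¬ IsUnit w) : iterQuot f M ∣ w := by
  have hf0 := hf.constantCoeff_eq_zero
  have hndvd : ¬ C (p : ℤ_[p]) ∣ w := fun h => hv1 <| by
    rw [eq_X_of_comp_comm PadicInt.prime_p hf0 hf.not_C_dvd hf' hv hcomm (hw ▸ h.mul_left _),
      coeff_one_X]
  obtain ⟨x, hx, hwx⟩ := exists_eval_eq_zero_of_not_isUnit hndvd hunit
  have hMx := hf.eval_iter_ne_zero_of_sub_X_eq hv hv1 hcomm hw hx hwx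
  have hfix : eval v x = x := by rw [← sub_eq_zero, eval_sub_self_eq hw hx, hwx, mul_zero]
  obtain ⟨k, hMy, hqy⟩ := exists_eval_iterQuot_eq_zero hf0 hx hMx
    (hf.exists_eval_iter_eq_zero hv hv1 hcomm hx hfix)
  have hfk := constantCoeff_iter hf0 k
  have hy : ‖eval (iter f k) x‖ < 1 := norm_eval_lt_one hfk hx
  have hyfix : eval v (eval (iter f k) x) = eval (iter f k) x := by
    rw [eval_comm hv hfk (comp_iter_comm hv hf0 hcomm.symm k) hx, hfix]
  refine (hf.isEisensteinSeries_iterQuot M).dvd_of_eval_eq_zero hy hqy ?_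
  rw [← mul_eq_zero_iff_left hMy, ← eval_sub_self_eq hw hy, hyfix, sub_self]

theorem constantCoeff_ne_zero_of_sub_X_eq (hf : IsUniformizerSeries f) (hv1 : coeff 1 v ≠ 1)
    {M : ℕ} (hw : v - X = iter f M * w) : constantCoeff w ≠ 0 := by
  rw [← sub_ne_zero, coeff_one_sub_one_eq hf.constantCoeff_eq_zero hw] at hv1
  exact right_ne_zero_of_mul hv1

theorem valuation_sub_one_eq (hf : IsUniformizerSeries f) (hv1 : coeff 1 v ≠ 1) {M : ℕ}
    (hw : v - X = iter f M * w) :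
    (coeff 1 v - 1).valuation = M + (constantCoeff w).valuation := by
  rw [coeff_one_sub_one_eq hf.constantCoeff_eq_zero hw,
    PadicInt.valuation_mul (pow_ne_zero M hf.coeff_one_ne_zero)
      (hf.constantCoeff_ne_zero_of_sub_X_eq hv1 hw),
    PadicInt.valuation_pow, hf.valuation_coeff_one, mul_one]

theorem iter_dvd_sub_X (hf : IsUniformizerSeries f) (hf' : C (p : ℤ_[p]) ∣ d⁄dX ℤ_[p] f)
    (hv : constantCoeff v = 0) (hv1 : coeff 1 v ≠ 1) (hcomm : comp f v = comp v f) {M : ℕ}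
    (hM : M ≤ (coeff 1 v - 1).valuation) : iter f M ∣ v - X := by
  induction M with
  | zero => exact X_dvd_iff.mpr (by rw [map_sub, hv, constantCoeff_X, sub_zero])
  | succ M ih =>
    obtain ⟨w, hw⟩ := ih (Nat.le_of_succ_le hM)
    have hunit : ¬ IsUnit w := fun h => by
      have hval := hf.valuation_sub_one_eq hv1 hw
      rw [(isUnit_iff_valuation_eq_zero (hf.constantCoeff_ne_zero_of_sub_X_eq hv1 hw)).mp
        (h.map constantCoeff)] at hval
      omega
    rw [hw, iter_succ_eq_mul hf.constantCoeff_eq_zero]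
    exact mul_dvd_mul_left _ (hf.iterQuot_dvd hf' hv hv1 hcomm hw hunit)

theorem associated_iter_sub_X (hf : IsUniformizerSeries f) (hf' : C (p : ℤ_[p]) ∣ d⁄dX ℤ_[p] f)
    (hv : constantCoeff v = 0) (hv1 : coeff 1 v ≠ 1) (hcomm : comp f v = comp v f) :
    Associated (iter f (coeff 1 v - 1).valuation) (v - X) := by
  obtain ⟨w, hw⟩ := hf.iter_dvd_sub_X hf' hv hv1 hcomm le_rfl
  have hval := hf.valuation_sub_one_eq hv1 hw
  have hunit : IsUnit w := isUnit_iff_constantCoeff.mpr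
    ((isUnit_iff_valuation_eq_zero (hf.constantCoeff_ne_zero_of_sub_X_eq hv1 hw)).mpr (by omega))
  exact hw ▸ associated_mul_unit_right _ w hunit

theorem eval_eq_self_iff (hf : IsUniformizerSeries f) (hf' : C (p : ℤ_[p]) ∣ d⁄dX ℤ_[p] f)
    (hv : constantCoeff v = 0) (hv1 : coeff 1 v ≠ 1) (hcomm : comp f v = comp v f)
    (hx : ‖x‖ < 1) : eval v x = x ↔ eval (iter f (coeff 1 v - 1).valuation) x = 0 := by
  have h := ((hf.associated_iter_sub_X hf' hv hv1 hcomm).map (evalHom x hx)).eq_zero_iff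
  rw [evalHom_apply, evalHom_apply, eval_sub _ _ hx, eval_X, sub_eq_zero] at h
  exact h.symm

theorem eval_iter_eq_self_iff (hf : IsUniformizerSeries f) (hu : constantCoeff u = 0)
    (hcomm : comp f u = comp u f) (hu1 : delta p ≤ (coeff 1 u - 1).valuation) {d : ℕ}
    (hd : d ≠ 0) (hx : ‖x‖ < 1) :
    eval (iter u d) x = x ↔
      eval (iter f ((coeff 1 u - 1).valuation + padicValNat p d)) x = 0 := by
  have hord : ¬ IsOfFinOrder (coeff 1 u) := fun h => by
    obtain ⟨d, hd, h⟩ := isOfFinOrder_iff_pow_eq_one.mp h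
    exact pow_ne_one_of_delta_le hu1 hd.ne' h
  have hd1 : coeff 1 (iter u d) ≠ 1 := by
    rw [coeff_one_iter hu]
    exact pow_ne_one_of_delta_le hu1 hd
  rw [hf.eval_eq_self_iff (hf.C_p_dvd_derivative hu (isUnit_of_delta_le hu1) hord hcomm)
    (constantCoeff_iter hu d) hd1 (comp_iter_comm hf.constantCoeff_eq_zero hu hcomm d) hx,
    coeff_one_iter hu, valuation_pow_sub_one hu1 hd]

theorem eval_iter_add_eq_iff (hf : IsUniformizerSeries f) (hu : constantCoeff u = 0)
    (hcomm : comp f u = comp u f) (hu1 : delta p ≤ (coeff 1 u - 1).valuation) {n : ℕ}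
    (hn : (coeff 1 u - 1).valuation ≤ n) (hx : x ∈ newRootSet f (n + 1)) (i d : ℕ) :
    eval (iter u (d + i)) x = eval (iter u i) x ↔
      p ^ (n - (coeff 1 u - 1).valuation + 1) ∣ d := by
  rcases eq_or_ne d 0 with rfl | hd
  · simp
  have hf0 := hf.constantCoeff_eq_zero
  have hx1 : ‖x‖ < 1 := hx.1.1
  have hui := constantCoeff_iter hu i
  have hunit : IsUnit (coeff 1 (iter u i)) := by
    rw [coeff_one_iter hu]
    exact (isUnit_of_delta_le hu1).pow i
  rw [eval_iter_add hu _ _ hx1,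
    hf.eval_iter_eq_self_iff hu hcomm hu1 hd (norm_eval_lt_one hui hx1),
    eval_iter_eval_eq_zero_iff hf0 hui hunit (comp_iter_comm hf0 hu hcomm i) _ hx1,
    eval_iter_eq_zero_iff_of_mem_newRootSet hf0 hx, padicValNat_dvd_iff_le hd]
  omega

end IsUniformizerSeries

end PadicDyn

theorem mainTheorem4_general (p : ℕ) [Fact p.Prime] (f u : PowerSeries ℤ_[p])
    (hf : PowerSeries.constantCoeff f = 0) (hwideg : PadicDyn.wideg f ≠ ⊤)
    (hf1 : (PowerSeries.coeff 1 f).valuation = 1) (hu : PowerSeries.constantCoeff u = 0)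
    (hcomm : PadicDyn.comp f u = PadicDyn.comp u f) (s : ℕ)
    (hu1 : (PowerSeries.coeff 1 u - 1).valuation = s) (hs : PadicDyn.delta p ≤ s) (n : ℕ)
    (hn : s ≤ n) :
    (∀ π ∈ PadicDyn.newRootSet f (n + 1), ∀ i j : ℕ,
      PadicDyn.eval (PadicDyn.iter u i) π = PadicDyn.eval (PadicDyn.iter u j) π ↔
        (p : ℤ) ^ (n - s + 1) ∣ (j : ℤ) - (i : ℤ)) ∧
    PadicDyn.rootSet f n = PadicDyn.fixedSet u (n - s) := by
  subst hu1
  have hfU : PadicDyn.IsUniformizerSeries f :=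
    ⟨hf, fun h => hwideg (PowerSeries.order_eq_top.mpr
      ((PadicDyn.map_residue_eq_zero_iff f).mpr h)), hf1⟩
  constructor
  · intro π hπ i j
    rcases le_total i j with hij | hij <;> obtain ⟨d, rfl⟩ := Nat.exists_eq_add_of_le' hij
    · rw [eq_comm, hfU.eval_iter_add_eq_iff hu hcomm hs hn hπ i d, Nat.cast_add,
        add_sub_cancel_right]
      norm_cast
    · rw [hfU.eval_iter_add_eq_iff hu hcomm hs hn hπ j d, Nat.cast_add, dvd_sub_comm,
        add_sub_cancel_right]
      norm_cast
  · ext x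
    refine and_congr_right fun hx => ?_
    have hpn : p ^ (n - (PowerSeries.coeff 1 u - 1).valuation) ≠ 0 :=
      pow_ne_zero _ (Fact.out : p.Prime).ne_zero
    rw [hfU.eval_iter_eq_self_iff hu hcomm hs hpn hx, padicValNat.prime_pow,
      Nat.add_sub_cancel' hn]

theorem mainTheorem4 (p : ℕ) [Fact p.Prime] (f u : PowerSeries ℤ_[p])
    (hfu : PadicDyn.IsMinimalCommutingPair f u) (n : ℕ) (hn : PadicDyn.delta p ≤ n) :
    (∀ π ∈ PadicDyn.newRootSet f (n + 1), ∀ i j : ℕ,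
      PadicDyn.eval (PadicDyn.iter u i) π = PadicDyn.eval (PadicDyn.iter u j) π ↔
        (p : ℤ) ^ (n - PadicDyn.delta p + 1) ∣ (j : ℤ) - (i : ℤ)) ∧
    PadicDyn.rootSet f n = PadicDyn.fixedSet u (n - PadicDyn.delta p) :=
  mainTheorem4_general p f u hfu.f_mem.1 (hfu.wideg_eq ▸ ENat.natCast_ne_top p) hfu.valuation_f
    hfu.u_invertible.1.1 hfu.commute _ hfu.valuation_u le_rfl n hn
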